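/- Let $0<\alpha\le 2$ and let $S_\alpha(\sigma,0,0)$ denote the law on $\mathbb R$ with characteristic function $\theta\mapsto e^{-\sigma^\alpha|\theta|^\alpha}$ ($\sigma\ge 0$). For a random variable $X$ with this law write $\|X\|_\alpha=\sigma$. Let $M$ be a symmetric $\alpha$-stable random measure on $\mathbb R$ with Lebesgue control measure $\mathcal L$ (independently scattered, almost surely $\sigma$-additive, $M(A)\sim S_\alpha(\mathcal L(A)^{1/\alpha},0,0)$ for measurable $A$ with $\mathcal L(A)<\infty$). Let $g\in L^\alpha(\mathbb R)$ be real-valued and let $Y(t)=\int g(t-x)\,M(dx)$, $t\in\mathbb R$. Suppose there are real numbers $c_0^+,c_0^-,\gamma,a,c,\eta$ with $c>0$, $\eta>0$ and $0<\gamma+1/\alpha<a\le 1$ such that $g(r)/r^\gamma\to c_0^+$ and $g(-r)/r^\gamma\to c_0^-$ as $r\searrow 0$, and $$|g(u+h)-g(u)|\le c\,|h|^a|u|^{\gamma-a}\qquad(u\in\mathbb R\setminus\{0\},\ |h|<\eta).$$ For integers $\omega\ge 1$, $\Omega\ge 1$ and $k\in\mathbb Z$ put $$Y_{\omega,\Omega}(k)=\sum_{j=-\omega\Omega+1}^{0}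 g\Big(\frac{j-1}{\omega}\Big)Z_{\alpha,\omega}(\omega k-j)+\sum_{j=1}^{\omega\Omega} g\Big(\frac{j}{\omega}\Big)Z_{\alpha,\omega}(\omega k-j),\qquad Z_{\alpha,\omega}(j)=M\Big(\frac{j+1}{\omega}\Big)-M\Big(\frac{j}{\omega}\Big),$$ where $M(t)=\int_0^t M(dx)$. Then $Y(k)-Y_{\omega,\Omega}(k)$ is symmetric $\alpha$-stable, and for every $k\in\mathbb Z$ $$\|Y(k)-Y_{\omega,\Omega}(k)\|_\alpha\to 0\quad\text{as }\omega\to\infty\text{ and }\Omega\to\infty .$$ If in addition there are $C>0$ and $\beta>1/\alpha$ such that $|g(x)|\le C|x|^{-\beta}$ for all sufficiently large $|x|$, then there is a constant $K>0$, independent of $k,\omega,\Omega$, such that for all $k\in\mathbb Z$ and all integers $\omega>1/\eta$, $\Omega\ge 1$, $$\|Y(k)-Y_{\omega,\Omega}(k)\|_\alpha^\alpha\le K\left(\omega^{-1-\alpha\gamma}+\Omega^{1-\alpha\beta}\right).$$ -/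

import Mathlib

open MeasureTheory ProbabilityTheory Filter Topology

/-- The real random variable `X` on `(S, P)` has the symmetric `α`-stable law `S_α(σ, 0, 0)` with
scale parameter `σ ≥ 0`: its characteristic function is `θ ↦ exp (-σ ^ α |θ| ^ α)`. -/
def HasSymmetricStableLaw {S : Type*} [MeasurableSpace S] (P : Measure S) (α σ : ℝ)
    (X : S → ℝ) : Prop :=
  0 ≤ σ ∧ AEMeasurable X P ∧
    ∀ θ : ℝ, charFun (P.map X) θ = Complex.exp (-((σ ^ α * |θ| ^ α : ℝ) : ℂ))

/-- The `α`-norm `‖X‖_α` of a symmetric `α`-stable random variable `X`, that is, its scale factor: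
the unique `σ ≥ 0` such that `X` has law `S_α(σ, 0, 0)` (the set below has at most one element;
the value is only meaningful if there is such a `σ`). -/
noncomputable def stableNorm {S : Type*} [MeasurableSpace S] (P : Measure S) (α : ℝ)
    (X : S → ℝ) : ℝ :=
  sInf {σ : ℝ | HasSymmetricStableLaw P α σ X}

/-- `M` is a symmetric `α`-stable random measure on `E` with control measure `m`: an independently
scattered, almost surely `σ`-additive random set function on the measurable sets of finite
`m`-measure such that `M A` has law `S_α(m(A) ^ (1 / α), 0, 0)`.  The values of `M` on all other
sets are irrelevant. -/
structure IsSymmetricStableRandomMeasure {S E : Type*} [MeasurableSpace S] [MeasurableSpace E]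
    (P : Measure S) (α : ℝ) (m : Measure E) (M : Set E → S → ℝ) : Prop where
  measurable : ∀ A : Set E, MeasurableSet A → m A < ⊤ → Measurable (M A)
  law : ∀ A : Set E, MeasurableSet A → m A < ⊤ →
    HasSymmetricStableLaw P α ((m A).toReal ^ (1 / α)) (M A)
  indep : ∀ (n : ℕ) (A : Fin n → Set E), (∀ i, MeasurableSet (A i)) → (∀ i, m (A i) < ⊤) →
    Pairwise (fun i j => Disjoint (A i) (A j)) → iIndepFun (fun i => M (A i)) P
  sigma_additive : ∀ A : ℕ → Set E, (∀ i, MeasurableSet (A i)) → m (⋃ i, A i) < ⊤ →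
    Pairwise (fun i j => Disjoint (A i) (A j)) →
    ∀ᵐ s ∂P, Tendsto (fun n : ℕ => ∑ i ∈ Finset.range n, M (A i) s) atTop (𝓝 (M (⋃ i, A i) s))

/-- The integral `∑ y, y M(f = y)` of a simple function `f` with respect to `M`. -/
noncomputable def simpleStableIntegral {S E : Type*} [MeasurableSpace E]
    (M : Set E → S → ℝ) (f : SimpleFunc E ℝ) : S → ℝ :=
  fun s => ∑ y ∈ f.range, y * M (f ⁻¹' {y}) s

/-- `X` is (a version of) the stochastic integral `∫ f dM`: the limit in probability of the
integrals of simple functions, with support of finite measure, converging to `f` in `L ^ α(m)`. -/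
def IsStableIntegral {S E : Type*} [MeasurableSpace S] [MeasurableSpace E]
    (P : Measure S) (α : ℝ) (m : Measure E) (M : Set E → S → ℝ) (f : E → ℝ) (X : S → ℝ) : Prop :=
  Measurable X ∧ ∃ φ : ℕ → SimpleFunc E ℝ,
    (∀ n, (φ n).FinMeasSupp m) ∧
    Tendsto (fun n => eLpNorm (fun x => φ n x - f x) (ENNReal.ofReal α) m) atTop (𝓝 0) ∧
    TendstoInMeasure P (fun n => simpleStableIntegral M (φ n)) atTop X

open Classical in
/-- The stochastic integral `∫ f dM` (determined up to almost sure equality). -/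
noncomputable def stableIntegral {S E : Type*} [MeasurableSpace S] [MeasurableSpace E]
    (P : Measure S) (α : ℝ) (m : Measure E) (M : Set E → S → ℝ) (f : E → ℝ) : S → ℝ :=
  if h : ∃ X : S → ℝ, IsStableIntegral P α m M f X then h.choose else 0

/-- `Y` is the moving average process with kernel `g`: for each `t`, almost surely,
`Y(t) = ∫ g(t - x) M(dx)`. -/
def IsMovingAverage {S : Type*} [MeasurableSpace S] (P : Measure S) (α : ℝ)
    (M : Set ℝ → S → ℝ) (g : ℝ → ℝ) (Y : ℝ → S → ℝ) : Prop :=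
  ∀ t : ℝ, Y t =ᵐ[P] stableIntegral P α volume M (fun x => g (t - x))

/-- The process `M(t) = ∫_0^t M(dx)`, with `∫_0^t = -∫_t^0` for `t < 0`. -/
noncomputable def stableMotion {S : Type*} (M : Set ℝ → S → ℝ) (t : ℝ) : S → ℝ :=
  fun s => if 0 ≤ t then M (Set.Ioc 0 t) s else -M (Set.Ioc t 0) s

/-- `Z_{α,ω}(j) = M((j + 1) / ω) - M(j / ω)`. -/
noncomputable def stableIncrement {S : Type*} (M : Set ℝ → S → ℝ) (ω : ℕ) (j : ℤ) : S → ℝ :=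
  fun s => stableMotion M (((j : ℝ) + 1) / (ω : ℝ)) s - stableMotion M ((j : ℝ) / (ω : ℝ)) s

/-- The approximation `Y_{ω,Ω}(k)` of `Y(k)` with discretization step `1 / ω` and cut-off `Ω`. -/
noncomputable def movingAverageApprox {S : Type*} (M : Set ℝ → S → ℝ) (g : ℝ → ℝ)
    (ω Ω : ℕ) (k : ℤ) : S → ℝ :=
  fun s =>
    ∑ j ∈ Finset.Icc (-((ω : ℤ) * (Ω : ℤ)) + 1) 0,
        g (((j : ℝ) - 1) / (ω : ℝ)) * stableIncrement M ω ((ω : ℤ) * k - j) s +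
      ∑ j ∈ Finset.Icc (1 : ℤ) ((ω : ℤ) * (Ω : ℤ)),
        g ((j : ℝ) / (ω : ℝ)) * stableIncrement M ω ((ω : ℤ) * k - j) s

/-- The approximation error `Y(k) - Y_{ω,Ω}(k)`. -/
noncomputable def approxError {S : Type*} (M : Set ℝ → S → ℝ) (g : ℝ → ℝ) (Y : ℝ → S → ℝ)
    (ω Ω : ℕ) (k : ℤ) : S → ℝ :=
  fun s => Y (k : ℝ) s - movingAverageApprox M g ω Ω k s

/-!
Stable integration is isometric: for simple functions independence turns sums of values of `M` into
sums of `α`-th powers of scales, and this passes through limits in probability, so that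
`‖∫ f dM‖_α = ‖f‖_{L ^ α}`. The error is the integral of `x ↦ (g - g_{ω,Ω}) (k - x)` with
`g_{ω,Ω}` a step function, and by translation invariance `k` plays no role in its norm.

A cell of mesh `δ = 1 / ω` is evaluated at its endpoint away from the origin, which is at distance
at least `max |u| δ` from `0` for every `u` in the cell. Since `γ - a < 0`, the increment bound
taken at that endpoint gives an error of at most `c δ ^ a (max |u| δ) ^ (γ - a)` even near the
singularity of `g`; as `α (γ - a) < -1`, its `α`-th power integrates to a multiple of
`δ ^ (1 + α γ)`. What remains is the tail of `|g| ^ α` beyond `Ω`.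
-/

namespace HasSymmetricStableLaw

variable {S : Type*} [MeasurableSpace S] {P : Measure S} {α σ τ : ℝ} {X Y : S → ℝ}

theorem congr (h : HasSymmetricStableLaw P α σ X) (hXY : X =ᵐ[P] Y) :
    HasSymmetricStableLaw P α σ Y :=
  ⟨h.1, h.2.1.congr hXY, by simpa only [Measure.map_congr hXY] using h.2.2⟩

theorem unique (hα : 0 < α) (h : HasSymmetricStableLaw P α σ X)
    (h' : HasSymmetricStableLaw P α τ X) : σ = τ := by
  have hexp := (h.2.2 1).symm.trans (h'.2.2 1)
  rw [← Complex.ofReal_neg, ← Complex.ofReal_neg, ← Complex.ofReal_exp, ← Complex.ofReal_exp,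
    Complex.ofReal_inj, Real.exp_eq_exp] at hexp
  simp only [abs_one, Real.one_rpow, mul_one, neg_inj] at hexp
  exact (Real.rpow_left_inj h.1 h'.1 hα.ne').1 hexp

theorem stableNorm_eq (hα : 0 < α) (h : HasSymmetricStableLaw P α σ X) :
    stableNorm P α X = σ := by
  have : {τ : ℝ | HasSymmetricStableLaw P α τ X} = {σ} :=
    Set.eq_singleton_iff_unique_mem.2 ⟨h, fun _ hτ => hτ.unique hα h⟩
  rw [stableNorm, this, csInf_singleton]

theorem const_mul (h : HasSymmetricStableLaw P α σ X) (c : ℝ) :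
    HasSymmetricStableLaw P α (|c| * σ) (fun s => c * X s) := by
  refine ⟨mul_nonneg (abs_nonneg c) h.1, h.2.1.const_mul c, fun θ => ?_⟩
  rw [charFun_map_mul_comp h.2.1, h.2.2, abs_mul, Real.mul_rpow (abs_nonneg c) (abs_nonneg θ),
    Real.mul_rpow (abs_nonneg c) h.1, mul_left_comm, mul_assoc]

theorem sum {ι : Type*} [Fintype ι] {σ : ι → ℝ} {X : ι → S → ℝ} (hα : α ≠ 0)
    (hX : ∀ i, HasSymmetricStableLaw P α (σ i) (X i)) (hindep : iIndepFun X P) :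
    HasSymmetricStableLaw P α ((∑ i, σ i ^ α) ^ (1 / α)) (fun s => ∑ i, X i s) := by
  have hsum : 0 ≤ ∑ i, σ i ^ α := Finset.sum_nonneg fun i _ => Real.rpow_nonneg (hX i).1 α
  refine ⟨Real.rpow_nonneg hsum _, Finset.aemeasurable_fun_sum _ fun i _ => (hX i).2.1,
    fun θ => ?_⟩
  rw [hindep.charFun_map_fun_sum_eq_prod fun i => (hX i).2.1, Finset.prod_apply,
    Finset.prod_congr rfl fun i _ => (hX i).2.2 θ, ← Complex.exp_sum, one_div,
    Real.rpow_inv_rpow hsum hα, Finset.sum_mul]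
  push_cast
  rw [Finset.sum_neg_distrib]

theorem norm_one_sub_charFun_le (h : HasSymmetricStableLaw P α σ X) (θ : ℝ) :
    ‖1 - charFun (P.map X) θ‖ ≤ σ ^ α * |θ| ^ α := by
  have hnonneg : 0 ≤ σ ^ α * |θ| ^ α :=
    mul_nonneg (Real.rpow_nonneg h.1 α) (Real.rpow_nonneg (abs_nonneg θ) α)
  rw [h.2.2 θ, ← Complex.ofReal_neg, ← Complex.ofReal_exp, ← Complex.ofReal_one,
    ← Complex.ofReal_sub, Complex.norm_real, Real.norm_eq_abs,
    abs_of_nonneg (sub_nonneg.2 (Real.exp_le_one_iff.2 (neg_nonpos.2 hnonneg)))]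
  linarith [Real.one_sub_le_exp_neg (σ ^ α * |θ| ^ α)]

variable [IsProbabilityMeasure P]

theorem ae_eq_zero (hα : α ≠ 0) (h : HasSymmetricStableLaw P α 0 X) : X =ᵐ[P] 0 := by
  have := Measure.isProbabilityMeasure_map h.2.1
  have hdirac : P.map X = Measure.dirac 0 := by
    refine Measure.ext_of_charFun (funext fun θ => ?_)
    simp [h.2.2 θ, charFun_dirac, Real.zero_rpow hα]
  refine ae_of_ae_map h.2.1 (p := fun x => x = 0) ?_
  simp [hdirac, ae_dirac_eq]

theorem measureReal_lt_abs_le (hα : 0 ≤ α) (h : HasSymmetricStableLaw P α σ X) {r : ℝ}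
    (hr : 0 < r) : P.real {s | r < |X s|} ≤ 2 * (2 * σ / r) ^ α := by
  have := Measure.isProbabilityMeasure_map h.2.1
  have hr' : 0 < r⁻¹ := inv_pos.2 hr
  have hbound : ∀ θ ∈ Set.uIoc (-2 * r⁻¹) (2 * r⁻¹),
      ‖1 - charFun (P.map X) θ‖ ≤ σ ^ α * (2 * r⁻¹) ^ α := by
    intro θ hθ
    rw [Set.uIoc_of_le (by linarith)] at hθ
    have hθr : |θ| ≤ 2 * r⁻¹ := abs_le.2 ⟨by linarith [hθ.1], hθ.2⟩
    have hσ := Real.rpow_nonneg h.1 α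
    exact (h.norm_one_sub_charFun_le θ).trans (by gcongr)
  calc P.real {s | r < |X s|}
      = (P.map X).real {x | r < |x|} := (map_measureReal_apply_of_aemeasurable h.2.1
        (measurableSet_lt measurable_const measurable_id.abs)).symm
    _ ≤ 2⁻¹ * r * ‖∫ θ in -2 * r⁻¹..2 * r⁻¹, 1 - charFun (P.map X) θ‖ :=
        measureReal_abs_gt_le_integral_charFun hr
    _ ≤ 2⁻¹ * r * (σ ^ α * (2 * r⁻¹) ^ α * |2 * r⁻¹ - -2 * r⁻¹|) := by
        gcongr
        exact intervalIntegral.norm_integral_le_of_norm_le_const hbound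
    _ = 2 * (2 * σ / r) ^ α := by
        rw [← Real.mul_rpow h.1 (by positivity), abs_of_nonneg (by linarith),
          show σ * (2 * r⁻¹) = 2 * σ / r by ring]
        field_simp
        ring

theorem of_tendstoInMeasure {σ : ℕ → ℝ} {X : ℕ → S → ℝ} (hα : 0 < α)
    (hX : ∀ n, HasSymmetricStableLaw P α (σ n) (X n)) (hσ : Tendsto σ atTop (𝓝 τ))
    (hXY : TendstoInMeasure P X atTop Y) : HasSymmetricStableLaw P α τ Y := by
  refine ⟨ge_of_tendsto' hσ fun n => (hX n).1, hXY.aemeasurable fun n => (hX n).2.1, fun θ => ?_⟩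
  have hchar := ProbabilityMeasure.tendsto_iff_tendsto_charFun.1
    (hXY.tendstoInDistribution fun n => (hX n).2.1).tendsto θ
  simp only [ProbabilityMeasure.coe_mk, (hX _).2.2] at hchar
  have hcont : Continuous fun v : ℝ => Complex.exp (-((v * |θ| ^ α : ℝ) : ℂ)) := by fun_prop
  exact tendsto_nhds_unique hchar
    ((hcont.tendsto _).comp ((Real.continuousAt_rpow_const τ α (Or.inr hα.le)).tendsto.comp hσ))

end HasSymmetricStableLaw

section ConvergenceInMeasure

variable {S ι E : Type*} [MeasurableSpace S] {P : Measure S} {l : Filter ι}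

theorem tendstoInMeasure_add [SeminormedAddCommGroup E] {X X' : ι → S → E} {Y Y' : S → E}
    (h : TendstoInMeasure P X l Y) (h' : TendstoInMeasure P X' l Y') :
    TendstoInMeasure P (fun i => X i + X' i) l (Y + Y') := by
  intro ε hε
  have hε2 : 0 < ε / 2 := ENNReal.half_pos hε.ne'
  have hsum := (h _ hε2).add (h' _ hε2)
  rw [add_zero] at hsum
  refine tendsto_of_tendsto_of_tendsto_of_le_of_le tendsto_const_nhds hsum
    (fun _ => zero_le) fun i => (measure_mono fun s hs => ?_).trans (measure_union_le _ _)
  by_contra! hlt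
  simp only [Set.mem_union, Set.mem_ofPred_eq, not_or, not_le] at hlt
  have hadd := (edist_add_add_le (X i s) (X' i s) (Y s) (Y' s)).trans_lt
    (ENNReal.add_lt_add hlt.1 hlt.2)
  rw [ENNReal.add_halves] at hadd
  exact hadd.not_ge hs

theorem tendstoInMeasure_const_smul {𝕜 : Type*} [SeminormedRing 𝕜] [SeminormedAddCommGroup E]
    [Module 𝕜 E] [IsBoundedSMul 𝕜 E] {X : ι → S → E} {Y : S → E}
    (h : TendstoInMeasure P X l Y) (c : 𝕜) :
    TendstoInMeasure P (fun i => c • X i) l (c • Y) := by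
  intro ε hε
  refine tendsto_of_tendsto_of_tendsto_of_le_of_le tendsto_const_nhds
    (h (ε / ‖c‖ₑ) (ENNReal.div_pos hε.ne' enorm_ne_top)) (fun _ => zero_le)
    fun i => measure_mono fun s hs => ?_
  exact ENNReal.div_le_of_le_mul' (le_trans hs (edist_smul_le c (X i s) (Y s)))

theorem exists_strictMono_tendsto_ae_of_cauchy_measure [PseudoMetricSpace E] [CompleteSpace E]
    [MeasurableSpace E] [BorelSpace E] {X : ℕ → S → E} (hX : ∀ n, AEMeasurable (X n) P)
    (hcauchy : ∀ ε : ℝ, 0 < ε →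
      Tendsto (fun n : ℕ × ℕ => P {s | ε < dist (X n.1 s) (X n.2 s)}) atTop (𝓝 0)) :
    ∃ (Y : S → E) (ns : ℕ → ℕ), Measurable Y ∧ StrictMono ns ∧
      ∀ᵐ s ∂P, Tendsto (fun n => X (ns n) s) atTop (𝓝 (Y s)) := by
  have hfast : ∀ n : ℕ, ∃ N, ∀ i ≥ N, ∀ j ≥ i,
      P {s | (1 / 2 : ℝ) ^ n < dist (X i s) (X j s)} ≤ ENNReal.ofReal ((1 / 2) ^ n) := by
    intro n
    have hpos : (0 : ℝ) < (1 / 2) ^ n := by positivity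
    obtain ⟨⟨N, N'⟩, hN⟩ := eventually_atTop.1
      ((hcauchy _ hpos).eventually_le_const (ENNReal.ofReal_pos.2 hpos))
    exact ⟨max N N', fun i hi j hij =>
      hN (i, j) ⟨(le_max_left _ _).trans hi, (le_max_right _ _).trans (hi.trans hij)⟩⟩
  obtain ⟨ns, hns, hdist⟩ := extraction_forall_of_eventually' hfast
  have hgeom : Summable fun n : ℕ => (1 / 2 : ℝ) ^ n := summable_geometric_two
  have hsum : ∑' n, P {s | (1 / 2 : ℝ) ^ n < dist (X (ns n) s) (X (ns (n + 1)) s)} ≠ ⊤ :=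
    ne_top_of_le_ne_top hgeom.tsum_ofReal_ne_top
      (ENNReal.tsum_le_tsum fun n => hdist n _ (hns.monotone n.le_succ))
  have hlim : ∀ᵐ s ∂P, ∃ y, Tendsto (fun n => X (ns n) s) atTop (𝓝 y) := by
    filter_upwards [ae_eventually_notMem hsum] with s hs
    refine cauchySeq_tendsto_of_complete (cauchySeq_of_summable_dist ?_)
    refine Summable.of_norm_bounded_eventually_nat hgeom ?_
    filter_upwards [hs] with n hn
    rw [Real.norm_of_nonneg dist_nonneg]
    exact not_lt.1 hn
  obtain ⟨Y, hY, hYlim⟩ := measurable_limit_of_tendsto_metrizable_ae (fun n => hX (ns n)) hlim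
  exact ⟨Y, ns, hY, hns, hYlim⟩

end ConvergenceInMeasure

section LpQuasinorm

variable {E F : Type*} [MeasurableSpace E] [NormedAddCommGroup F] {m : Measure E} {p : ENNReal}

theorem eLpNorm_add_rpow_le {f g : E → F} (hf : AEStronglyMeasurable f m)
    (hg : AEStronglyMeasurable g m) :
    eLpNorm (f + g) p m ^ (min p 1).toReal ≤
      eLpNorm f p m ^ (min p 1).toReal + eLpNorm g p m ^ (min p 1).toReal := by
  rcases le_total 1 p with hp | hp
  · simpa [min_eq_right hp] using eLpNorm_add_le hf hg hp
  rcases eq_or_ne p 0 with rfl | hp0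
  · simp
  have hptop : p ≠ ⊤ := ne_top_of_le_ne_top ENNReal.one_ne_top hp
  have hp0' : 0 < p.toReal := ENNReal.toReal_pos hp0 hptop
  simp only [min_eq_left hp, eLpNorm_eq_eLpNorm' hp0 hptop,
    ← lintegral_rpow_enorm_eq_rpow_eLpNorm' hp0']
  rw [← lintegral_add_left' (hf.enorm.pow_const _)]
  refine lintegral_mono fun x => ?_
  exact (ENNReal.rpow_le_rpow (enorm_add_le _ _) hp0'.le).trans
    (ENNReal.rpow_add_le_add_rpow _ _ hp0'.le (by simpa using ENNReal.toReal_mono (by simp) hp))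

theorem tendsto_eLpNorm_add_zero {ι : Type*} {l : Filter ι} {f g : ι → E → F}
    (hf : ∀ i, AEStronglyMeasurable (f i) m) (hg : ∀ i, AEStronglyMeasurable (g i) m)
    (hf0 : Tendsto (fun i => eLpNorm (f i) p m) l (𝓝 0))
    (hg0 : Tendsto (fun i => eLpNorm (g i) p m) l (𝓝 0)) :
    Tendsto (fun i => eLpNorm (f i + g i) p m) l (𝓝 0) := by
  have hbound : Tendsto (fun i => p.LpAddConst * (eLpNorm (f i) p m + eLpNorm (g i) p m)) l
      (𝓝 0) := by
    simpa using ENNReal.Tendsto.const_mul (hf0.add hg0) (Or.inr p.LpAddConst_lt_top.ne)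
  exact tendsto_of_tendsto_of_tendsto_of_le_of_le tendsto_const_nhds hbound (fun _ => zero_le)
    fun i => eLpNorm_add_le' (hf i) (hg i) p

theorem tendsto_eLpNorm_of_tendsto_sub {ι : Type*} {l : Filter ι} {f : ι → E → F} {g : E → F}
    (hf : ∀ i, AEStronglyMeasurable (f i) m) (hg : MemLp g p m)
    (h : Tendsto (fun i => eLpNorm (f i - g) p m) l (𝓝 0)) :
    Tendsto (fun i => eLpNorm (f i) p m) l (𝓝 (eLpNorm g p m)) := by
  rcases eq_or_ne p 0 with rfl | hp0
  · simpa using tendsto_const_nhds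
  set r := (min p 1).toReal
  have hr0 : 0 < r := ENNReal.toReal_pos (by simp [hp0]) (by simp)
  have hsub : Tendsto (fun i => eLpNorm (f i - g) p m ^ r) l (𝓝 0) := by
    simpa [ENNReal.zero_rpow_of_pos hr0] using h.ennrpow_const r
  have hgtop : eLpNorm g p m ^ r ≠ ⊤ := ENNReal.rpow_ne_top_of_nonneg hr0.le hg.eLpNorm_ne_top
  have hlower : ∀ i, eLpNorm g p m ^ r - eLpNorm (f i - g) p m ^ r ≤ eLpNorm (f i) p m ^ r := by
    intro i
    rw [tsub_le_iff_right, eLpNorm_sub_comm]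
    simpa using eLpNorm_add_rpow_le (hf i) (hg.1.sub (hf i))
  have hupper : ∀ i, eLpNorm (f i) p m ^ r ≤ eLpNorm g p m ^ r + eLpNorm (f i - g) p m ^ r := by
    intro i
    simpa using eLpNorm_add_rpow_le hg.1 ((hf i).sub hg.1)
  have hpow : Tendsto (fun i => eLpNorm (f i) p m ^ r) l (𝓝 (eLpNorm g p m ^ r)) := by
    refine tendsto_of_tendsto_of_tendsto_of_le_of_le ?_ ?_ hlower hupper
    · simpa using ENNReal.Tendsto.sub (tendsto_const_nhds (x := eLpNorm g p m ^ r)) hsub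
        (Or.inl hgtop)
    · simpa using (tendsto_const_nhds (x := eLpNorm g p m ^ r)).add hsub
  simpa only [ENNReal.rpow_rpow_inv hr0.ne'] using hpow.ennrpow_const r⁻¹

end LpQuasinorm

theorem lpNorm_simpleFunc {E : Type*} [MeasurableSpace E] {m : Measure E} {α : ℝ} (hα : 0 < α)
    {φ : SimpleFunc E ℝ} (hφ : φ.FinMeasSupp m) :
    lpNorm φ (ENNReal.ofReal α) m =
      (∑ y ∈ φ.range with y ≠ 0, (|y| * (m (φ ⁻¹' {y})).toReal ^ (1 / α)) ^ α) ^ (1 / α) := by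
  rw [← toReal_eLpNorm φ.aestronglyMeasurable,
    eLpNorm_eq_eLpNorm' (by simpa using hα) ENNReal.ofReal_ne_top, ENNReal.toReal_ofReal hα.le,
    SimpleFunc.eLpNorm'_eq, ← ENNReal.toReal_rpow, ← Finset.sum_filter_of_ne (p := (· ≠ 0)),
    ENNReal.toReal_sum]
  · congr 1
    refine Finset.sum_congr rfl fun y _ => ?_
    rw [Real.mul_rpow (abs_nonneg y) (by positivity), one_div,
      Real.rpow_inv_rpow ENNReal.toReal_nonneg hα.ne', ENNReal.toReal_mul, ← ENNReal.toReal_rpow,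
      toReal_enorm, Real.norm_eq_abs]
  · intro y hy
    exact ENNReal.mul_ne_top (ENNReal.rpow_ne_top_of_nonneg hα.le enorm_ne_top)
      (SimpleFunc.finMeasSupp_iff.1 hφ y (Finset.mem_filter.1 hy).2).ne
  · rintro y - hy rfl
    simp [ENNReal.zero_rpow_of_pos hα] at hy

namespace IsSymmetricStableRandomMeasure

variable {S E : Type*} [MeasurableSpace S] [MeasurableSpace E] {P : Measure S} {α : ℝ}
  {m : Measure E} {M : Set E → S → ℝ}

theorem iIndepFun_of_pairwise_disjoint (hM : IsSymmetricStableRandomMeasure P α m M) {ι : Type*}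
    [Finite ι] {A : ι → Set E} (hA : ∀ i, MeasurableSet (A i)) (hmA : ∀ i, m (A i) < ⊤)
    (hd : Pairwise fun i j => Disjoint (A i) (A j)) : iIndepFun (fun i => M (A i)) P := by
  have := Fintype.ofFinite ι
  let e := Fintype.equivFin ι
  have h := (hM.indep _ (fun n => A (e.symm n)) (fun _ => hA _) (fun _ => hmA _)
    fun _ _ hij => hd (e.symm.injective.ne hij)).precomp e.injective
  simpa only [Equiv.symm_apply_apply] using h

theorem measurable_simpleStableIntegral (hM : IsSymmetricStableRandomMeasure P α m M)
    {φ : SimpleFunc E ℝ} (hφ : φ.FinMeasSupp m) : Measurable (simpleStableIntegral M φ) := by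
  refine Finset.measurable_fun_sum _ fun y _ => ?_
  by_cases hy : y = 0
  · simp [hy]
  · exact (hM.measurable _ (φ.measurableSet_fiber y)
      (SimpleFunc.finMeasSupp_iff.1 hφ y hy)).const_mul y

variable [IsProbabilityMeasure P]

theorem ae_eq_zero (hM : IsSymmetricStableRandomMeasure P α m M) (hα : α ≠ 0) {A : Set E}
    (hA : MeasurableSet A) (h0 : m A = 0) : M A =ᵐ[P] 0 := by
  have h := hM.law A hA (by simp [h0])
  rw [h0, ENNReal.toReal_zero, Real.zero_rpow (one_div_ne_zero hα)] at h
  exact h.ae_eq_zero hα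

theorem union (hM : IsSymmetricStableRandomMeasure P α m M) (hα : α ≠ 0) {A B : Set E}
    (hA : MeasurableSet A) (hB : MeasurableSet B) (hAB : Disjoint A B) (hmA : m A < ⊤)
    (hmB : m B < ⊤) : M (A ∪ B) =ᵐ[P] M A + M B := by
  let C : ℕ → Set E
    | 0 => A
    | 1 => B
    | _ + 2 => ∅
  have hC : ⋃ n, C n = A ∪ B := by
    rw [← Set.union_iUnion_nat_succ, ← Set.union_iUnion_nat_succ]
    simp [C]
  have hmeas : ∀ n, MeasurableSet (C n)
    | 0 => hA
    | 1 => hB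
    | _ + 2 => MeasurableSet.empty
  have hdisj : Pairwise fun i j => Disjoint (C i) (C j) := by
    rintro (_ | _ | i) (_ | _ | j) hij <;> simp_all [C, hAB.symm]
  have hadd := hM.sigma_additive C hmeas
    (by rw [hC]; exact measure_union_lt_top hmA hmB) hdisj
  rw [hC] at hadd
  filter_upwards [hadd, hM.ae_eq_zero hα MeasurableSet.empty measure_empty] with s hs hempty
  refine tendsto_nhds_unique ((tendsto_add_atTop_iff_nat 2).2 hs) ?_
  simp [Finset.sum_range_succ', C, hempty, add_comm (M B s)]

theorem biUnion_finset (hM : IsSymmetricStableRandomMeasure P α m M) (hα : α ≠ 0) {ι : Type*}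
    (t : Finset ι) {A : ι → Set E} (hA : ∀ i ∈ t, MeasurableSet (A i))
    (hmA : ∀ i ∈ t, m (A i) < ⊤) (hd : (t : Set ι).PairwiseDisjoint A) :
    M (⋃ i ∈ t, A i) =ᵐ[P] fun s => ∑ i ∈ t, M (A i) s := by
  classical
  induction t using Finset.induction_on with
  | empty =>
    simp only [Finset.notMem_empty, Set.iUnion_of_empty, Set.iUnion_empty, Finset.sum_empty]
    exact hM.ae_eq_zero hα MeasurableSet.empty measure_empty
  | insert i t hi ih =>
    simp only [Finset.forall_mem_insert, Finset.coe_insert] at hA hmA hd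
    have hunion := hM.union hα hA.1 (t.measurableSet_biUnion hA.2)
      (Set.disjoint_iUnion₂_right.2 fun j hj => hd (by simp) (by simp [hj]) (by grind)) hmA.1
      (measure_biUnion_lt_top t.finite_toSet hmA.2)
    rw [Finset.set_biUnion_insert]
    filter_upwards [hunion, ih hA.2 hmA.2 (hd.subset (by simp))] with s hs hs'
    rw [hs, Pi.add_apply, hs', Finset.sum_insert hi]

theorem simpleStableIntegral_eq_sum_of_subset (hM : IsSymmetricStableRandomMeasure P α m M)
    (hα : α ≠ 0) {φ : SimpleFunc E ℝ} {t : Finset ℝ} (ht : ∀ x, φ x ≠ 0 → φ x ∈ t) :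
    simpleStableIntegral M φ =ᵐ[P] fun s => ∑ y ∈ t, y * M (φ ⁻¹' {y}) s := by
  filter_upwards [hM.ae_eq_zero hα MeasurableSet.empty measure_empty] with s hs
  refine Finset.sum_congr_of_eq_on_inter (fun y hy hyt => ?_) (fun y _ hy => ?_) fun _ _ _ => rfl
  · obtain ⟨x, rfl⟩ := SimpleFunc.mem_range.1 hy
    rw [not_imp_comm.1 (ht x) hyt, zero_mul]
  · rw [(SimpleFunc.preimage_eq_empty_iff φ y).2 hy, hs, Pi.zero_apply, mul_zero]

theorem simpleStableIntegral_indicator_one (hM : IsSymmetricStableRandomMeasure P α m M)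
    (hα : α ≠ 0) {A : Set E} (hA : MeasurableSet A) :
    simpleStableIntegral M (SimpleFunc.piecewise A hA 1 0) =ᵐ[P] M A := by
  classical
  have hpre : SimpleFunc.piecewise A hA (1 : SimpleFunc E ℝ) 0 ⁻¹' {1} = A := by
    ext x
    by_cases hx : x ∈ A <;> simp [hx]
  refine (hM.simpleStableIntegral_eq_sum_of_subset hα (t := {1}) fun x hx => ?_).trans ?_
  · by_contra hxA
    simp_all
  · simp only [Finset.sum_singleton, one_mul, hpre, EventuallyEq.rfl]

theorem hasSymmetricStableLaw_simpleStableIntegral (hM : IsSymmetricStableRandomMeasure P α m M)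
    (hα : 0 < α) {φ : SimpleFunc E ℝ} (hφ : φ.FinMeasSupp m) :
    HasSymmetricStableLaw P α (lpNorm φ (ENNReal.ofReal α) m) (simpleStableIntegral M φ) := by
  classical
  let t := {y ∈ φ.range | y ≠ 0}
  have hfin : ∀ y : t, m (φ ⁻¹' {(y : ℝ)}) < ⊤ := fun y =>
    SimpleFunc.finMeasSupp_iff.1 hφ y (Finset.mem_filter.1 y.2).2
  have hindep : iIndepFun (fun y : t => M (φ ⁻¹' {(y : ℝ)})) P :=
    hM.iIndepFun_of_pairwise_disjoint (fun y => φ.measurableSet_fiber y) hfin fun y z hyz =>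
      Disjoint.preimage φ (Set.disjoint_singleton.2 (Subtype.coe_injective.ne hyz))
  have hlaw := HasSymmetricStableLaw.sum hα.ne'
    (fun y => (hM.law _ (φ.measurableSet_fiber _) (hfin y)).const_mul y)
    (hindep.comp (fun y x => (y : ℝ) * x) fun y => measurable_const_mul _)
  rw [Finset.sum_coe_sort t fun y => (|y| * (m (φ ⁻¹' {y})).toReal ^ (1 / α)) ^ α,
    ← lpNorm_simpleFunc hα hφ] at hlaw
  refine hlaw.congr (EventuallyEq.symm ?_)
  filter_upwards [hM.simpleStableIntegral_eq_sum_of_subset hα.ne' (φ := φ) (t := t)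
    fun x hx => Finset.mem_filter.2 ⟨SimpleFunc.mem_range_self φ x, hx⟩] with s hs
  rw [hs, ← Finset.sum_coe_sort]

theorem simpleStableIntegral_map (hM : IsSymmetricStableRandomMeasure P α m M) (hα : α ≠ 0)
    {β : Type*} (ψ : SimpleFunc E β) (h : β → ℝ) (hfin : (ψ.map h).FinMeasSupp m) :
    simpleStableIntegral M (ψ.map h) =ᵐ[P] fun s => ∑ b ∈ ψ.range, h b * M (ψ ⁻¹' {b}) s := by
  classical
  have hfiber : ∀ y ∈ (ψ.map h).range, ∀ᵐ s ∂P, y * M ((ψ.map h) ⁻¹' {y}) s =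
      ∑ b ∈ ψ.range with h b = y, h b * M (ψ ⁻¹' {b}) s := by
    intro y _
    rcases eq_or_ne y 0 with rfl | hy
    · refine Eventually.of_forall fun s => ?_
      rw [zero_mul, Finset.sum_eq_zero fun b hb => by rw [(Finset.mem_filter.1 hb).2, zero_mul]]
    have hpre : (ψ.map h) ⁻¹' {y} = ⋃ b ∈ ψ.range.filter (h · = y), ψ ⁻¹' {b} := by
      ext x
      simp
    have hunion := hM.biUnion_finset hα (ψ.range.filter (h · = y)) (A := fun b => ψ ⁻¹' {b})
      (fun b _ => ψ.measurableSet_fiber b)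
      (fun b hb => (measure_mono (hpre ▸ Set.subset_biUnion_of_mem (u := (ψ ⁻¹' {·})) hb)).trans_lt
        (SimpleFunc.finMeasSupp_iff.1 hfin y hy))
      (fun b _ b' _ hb => Disjoint.preimage ψ (Set.disjoint_singleton.2 hb))
    filter_upwards [hunion] with s hs
    rw [hpre, hs, Finset.mul_sum]
    exact Finset.sum_congr rfl fun b hb => by rw [(Finset.mem_filter.1 hb).2]
  filter_upwards [(ae_ball_iff (Finset.countable_toSet _)).2 hfiber] with s hs
  rw [simpleStableIntegral, Finset.sum_congr rfl hs, SimpleFunc.range_map]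
  exact Finset.sum_fiberwise_of_maps_to (fun b hb => Finset.mem_image_of_mem h hb) _

theorem simpleStableIntegral_add (hM : IsSymmetricStableRandomMeasure P α m M) (hα : α ≠ 0)
    {φ ψ : SimpleFunc E ℝ} (hφ : φ.FinMeasSupp m) (hψ : ψ.FinMeasSupp m) :
    simpleStableIntegral M (φ + ψ) =ᵐ[P]
      simpleStableIntegral M φ + simpleStableIntegral M ψ := by
  filter_upwards [hM.simpleStableIntegral_map hα (φ.pair ψ) Prod.fst hφ,
    hM.simpleStableIntegral_map hα (φ.pair ψ) Prod.snd hψ,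
    hM.simpleStableIntegral_map hα (φ.pair ψ) (fun z => z.1 + z.2) (hφ.add hψ)] with s h₁ h₂ h₃
  simp only [SimpleFunc.map_fst_pair, SimpleFunc.map_snd_pair] at h₁ h₂
  rw [Pi.add_apply, h₁, h₂, ← Finset.sum_add_distrib]
  exact h₃.trans (Finset.sum_congr rfl fun z _ => add_mul _ _ _)

theorem simpleStableIntegral_const_smul (hM : IsSymmetricStableRandomMeasure P α m M)
    (hα : α ≠ 0) (c : ℝ) {φ : SimpleFunc E ℝ} (hφ : φ.FinMeasSupp m) :
    simpleStableIntegral M (c • φ) =ᵐ[P] c • simpleStableIntegral M φ := by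
  filter_upwards [hM.simpleStableIntegral_map hα φ (c * ·) (hφ.map (mul_zero c))] with s hs
  simp only [mul_assoc, ← Finset.mul_sum] at hs
  exact hs

end IsSymmetricStableRandomMeasure

namespace IsStableIntegral

variable {S E : Type*} [MeasurableSpace S] [MeasurableSpace E] {P : Measure S} {α : ℝ}
  {m : Measure E} {M : Set E → S → ℝ} {f f' : E → ℝ} {X X' : S → ℝ}

theorem congr (h : IsStableIntegral P α m M f X) (hX' : Measurable X') (hXX' : X =ᵐ[P] X') :
    IsStableIntegral P α m M f X' := by
  obtain ⟨-, φ, hφ, hφf, hlim⟩ := h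
  exact ⟨hX', φ, hφ, hφf, hlim.congr_right hXX'⟩

variable [IsProbabilityMeasure P]

theorem hasSymmetricStableLaw (h : IsStableIntegral P α m M f X)
    (hM : IsSymmetricStableRandomMeasure P α m M) (hα : 0 < α)
    (hf : MemLp f (ENNReal.ofReal α) m) :
    HasSymmetricStableLaw P α (lpNorm f (ENNReal.ofReal α) m) X := by
  obtain ⟨-, φ, hφ, hφf, hlim⟩ := h
  refine .of_tendstoInMeasure hα
    (fun n => hM.hasSymmetricStableLaw_simpleStableIntegral hα (hφ n)) ?_ hlim
  have hnorm := tendsto_eLpNorm_of_tendsto_sub (fun n => (φ n).aestronglyMeasurable) hf hφf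
  rw [← toReal_eLpNorm hf.1]
  exact ((ENNReal.tendsto_toReal hf.eLpNorm_ne_top).comp hnorm).congr fun n =>
    toReal_eLpNorm (φ n).aestronglyMeasurable

theorem const_smul (h : IsStableIntegral P α m M f X)
    (hM : IsSymmetricStableRandomMeasure P α m M) (hα : α ≠ 0) (c : ℝ) :
    IsStableIntegral P α m M (c • f) (c • X) := by
  obtain ⟨hX, φ, hφ, hφf, hlim⟩ := h
  refine ⟨hX.const_smul c, fun n => c • φ n, fun n => (hφ n).map (mul_zero c), ?_,
    (tendstoInMeasure_const_smul hlim c).congr_left fun n =>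
      (hM.simpleStableIntegral_const_smul hα c (hφ n)).symm⟩
  have hsub : ∀ n, (fun x => (c • φ n) x - (c • f) x) = c • fun x => φ n x - f x := fun n => by
    ext x
    simp [mul_sub]
  simp only [hsub, eLpNorm_const_smul]
  simpa using ENNReal.Tendsto.const_mul hφf (Or.inr enorm_ne_top)

theorem add (h : IsStableIntegral P α m M f X) (h' : IsStableIntegral P α m M f' X')
    (hM : IsSymmetricStableRandomMeasure P α m M) (hα : α ≠ 0)
    (hf : AEStronglyMeasurable f m) (hf' : AEStronglyMeasurable f' m) :
    IsStableIntegral P α m M (f + f') (X + X') := by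
  obtain ⟨hX, φ, hφ, hφf, hlim⟩ := h
  obtain ⟨hX', φ', hφ', hφf', hlim'⟩ := h'
  refine ⟨hX.add hX', fun n => φ n + φ' n, fun n => (hφ n).add (hφ' n), ?_,
    (tendstoInMeasure_add hlim hlim').congr_left fun n =>
      (hM.simpleStableIntegral_add hα (hφ n) (hφ' n)).symm⟩
  refine (tendsto_eLpNorm_add_zero (fun n => (φ n).aestronglyMeasurable.sub hf)
    (fun n => (φ' n).aestronglyMeasurable.sub hf') hφf hφf').congr fun n => ?_
  congr 1
  ext x
  exact (add_sub_add_comm _ _ _ _).symm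

theorem sub (h : IsStableIntegral P α m M f X) (h' : IsStableIntegral P α m M f' X')
    (hM : IsSymmetricStableRandomMeasure P α m M) (hα : α ≠ 0)
    (hf : AEStronglyMeasurable f m) (hf' : AEStronglyMeasurable f' m) :
    IsStableIntegral P α m M (f - f') (X - X') := by
  simpa only [neg_one_smul, ← sub_eq_add_neg] using
    h.add (h'.const_smul hM hα (-1)) hM hα hf (hf'.const_smul (-1))

end IsStableIntegral

namespace IsSymmetricStableRandomMeasure

variable {S E : Type*} [MeasurableSpace S] [MeasurableSpace E] {P : Measure S} {α : ℝ}
  {m : Measure E} {M : Set E → S → ℝ}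

theorem isStableIntegral_simpleFunc (hM : IsSymmetricStableRandomMeasure P α m M)
    {φ : SimpleFunc E ℝ} (hφ : φ.FinMeasSupp m) :
    IsStableIntegral P α m M φ (simpleStableIntegral M φ) :=
  ⟨hM.measurable_simpleStableIntegral hφ, fun _ => φ, fun _ => hφ, by simp,
    fun ε hε => by simp [hε.not_ge]⟩

variable [IsProbabilityMeasure P]

theorem isStableIntegral_indicator (hM : IsSymmetricStableRandomMeasure P α m M) (hα : α ≠ 0)
    {A : Set E} (hA : MeasurableSet A) (hmA : m A < ⊤) :
    IsStableIntegral P α m M (A.indicator 1) (M A) := by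
  have hfin : (SimpleFunc.piecewise A hA (1 : SimpleFunc E ℝ) 0).FinMeasSupp m := by
    rw [SimpleFunc.finMeasSupp_iff_support]
    refine (measure_mono fun x hx => ?_).trans_lt hmA
    by_contra hxA
    simp_all
  simpa using (hM.isStableIntegral_simpleFunc hfin).congr (hM.measurable A hA hmA)
    (hM.simpleStableIntegral_indicator_one hα hA)

theorem isStableIntegral_sum_indicator (hM : IsSymmetricStableRandomMeasure P α m M)
    (hα : α ≠ 0) {ι : Type*} (t : Finset ι) (c : ι → ℝ) {A : ι → Set E}
    (hA : ∀ i ∈ t, MeasurableSet (A i)) (hmA : ∀ i ∈ t, m (A i) < ⊤) :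
    IsStableIntegral P α m M (∑ i ∈ t, c i • (A i).indicator 1) (∑ i ∈ t, c i • M (A i)) := by
  classical
  induction t using Finset.induction_on with
  | empty =>
    simpa using (hM.isStableIntegral_indicator hα MeasurableSet.empty (by simp)).const_smul
      hM hα 0
  | insert i t hi ih =>
    simp only [Finset.forall_mem_insert] at hA hmA
    rw [Finset.sum_insert hi, Finset.sum_insert hi]
    refine ((hM.isStableIntegral_indicator hα hA.1 hmA.1).const_smul hM hα (c i)).add
      (ih hA.2 hmA.2) hM hα ?_ ?_
    · exact (aestronglyMeasurable_one.indicator hA.1).const_smul (c i)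
    · exact Finset.aestronglyMeasurable_sum t fun j hj =>
        (aestronglyMeasurable_one.indicator (hA.2 j hj)).const_smul (c j)

theorem measure_lt_abs_sub_simpleStableIntegral_le
    (hM : IsSymmetricStableRandomMeasure P α m M) (hα : 0 < α) {φ ψ : SimpleFunc E ℝ}
    (hφ : φ.FinMeasSupp m) (hψ : ψ.FinMeasSupp m) {ε : ℝ} (hε : 0 < ε) :
    P {s | ε < |simpleStableIntegral M φ s - simpleStableIntegral M ψ s|} ≤
      ENNReal.ofReal (2 * (2 * lpNorm (φ - ψ : E → ℝ) (ENNReal.ofReal α) m / ε) ^ α) := by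
  have hint := (hM.isStableIntegral_simpleFunc hφ).sub (hM.isStableIntegral_simpleFunc hψ) hM
    hα.ne' φ.aestronglyMeasurable ψ.aestronglyMeasurable
  have hmemLp : ∀ {ξ : SimpleFunc E ℝ}, ξ.FinMeasSupp m → MemLp ξ (ENNReal.ofReal α) m :=
    (SimpleFunc.memLp_iff_finMeasSupp (by simpa using hα) ENNReal.ofReal_ne_top).2
  rw [← ofReal_measureReal]
  exact ENNReal.ofReal_le_ofReal
    ((hint.hasSymmetricStableLaw hM hα ((hmemLp hφ).sub (hmemLp hψ))).measureReal_lt_abs_le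
      hα.le hε)

theorem tendsto_measure_lt_dist_simpleStableIntegral
    (hM : IsSymmetricStableRandomMeasure P α m M) (hα : 0 < α) {f : E → ℝ}
    (hf : AEStronglyMeasurable f m) {φ : ℕ → SimpleFunc E ℝ} (hφ : ∀ n, (φ n).FinMeasSupp m)
    (hφf : Tendsto (fun n => eLpNorm (⇑(φ n) - f) (ENNReal.ofReal α) m) atTop (𝓝 0))
    {ε : ℝ} (hε : 0 < ε) :
    Tendsto (fun n : ℕ × ℕ => P {s | ε < dist (simpleStableIntegral M (φ n.1) s)
      (simpleStableIntegral M (φ n.2) s)}) atTop (𝓝 0) := by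
  rw [← prod_atTop_atTop_eq]
  have hnorm : Tendsto (fun n : ℕ × ℕ => eLpNorm (⇑(φ n.1) - ⇑(φ n.2)) (ENNReal.ofReal α) m)
      (atTop ×ˢ atTop) (𝓝 0) := by
    simpa using tendsto_eLpNorm_add_zero (f := fun n : ℕ × ℕ => ⇑(φ n.1) - f)
      (g := fun n => f - ⇑(φ n.2)) (fun n => (φ n.1).aestronglyMeasurable.sub hf)
      (fun n => hf.sub (φ n.2).aestronglyMeasurable) (hφf.comp tendsto_fst)
      ((hφf.comp tendsto_snd).congr fun n => eLpNorm_sub_comm _ _ _ _)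
  have hlpNorm : Tendsto (fun n : ℕ × ℕ => lpNorm (⇑(φ n.1) - ⇑(φ n.2)) (ENNReal.ofReal α) m)
      (atTop ×ˢ atTop) (𝓝 0) :=
    ((ENNReal.tendsto_toReal ENNReal.zero_ne_top).comp hnorm).congr fun n =>
      toReal_eLpNorm ((φ n.1).aestronglyMeasurable.sub (φ n.2).aestronglyMeasurable)
  have hbound : Tendsto (fun n : ℕ × ℕ => ENNReal.ofReal
      (2 * (2 * lpNorm (⇑(φ n.1) - ⇑(φ n.2)) (ENNReal.ofReal α) m / ε) ^ α))
      (atTop ×ˢ atTop) (𝓝 0) := by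
    have hcont : Continuous fun r : ℝ => 2 * (2 * r / ε) ^ α :=
      (((continuous_const_mul 2).div_const ε).rpow_const fun _ => Or.inr hα.le).const_mul 2
    have hzero : (2 : ℝ) * (2 * 0 / ε) ^ α = 0 := by simp [Real.zero_rpow hα.ne']
    rw [← ENNReal.ofReal_zero, ← hzero]
    exact ENNReal.tendsto_ofReal ((hcont.tendsto 0).comp hlpNorm)
  exact tendsto_of_tendsto_of_tendsto_of_le_of_le tendsto_const_nhds hbound (fun _ => zero_le)
    fun n => hM.measure_lt_abs_sub_simpleStableIntegral_le hα (hφ n.1) (hφ n.2) hε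

theorem exists_isStableIntegral (hM : IsSymmetricStableRandomMeasure P α m M) (hα : 0 < α)
    {f : E → ℝ} (hf : MemLp f (ENNReal.ofReal α) m) : ∃ X, IsStableIntegral P α m M f X := by
  obtain ⟨δ, -, hδ, hδ0⟩ := exists_seq_strictAnti_tendsto' ENNReal.zero_lt_top
  choose φ hφδ hφmem using fun n =>
    hf.exists_simpleFunc_eLpNorm_sub_lt ENNReal.ofReal_ne_top (hδ n).1.ne'
  have hφ : ∀ n, (φ n).FinMeasSupp m := fun n =>
    (SimpleFunc.memLp_iff_finMeasSupp (by simpa using hα) ENNReal.ofReal_ne_top).1 (hφmem n)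
  have hφf : Tendsto (fun n => eLpNorm (⇑(φ n) - f) (ENNReal.ofReal α) m) atTop (𝓝 0) :=
    tendsto_of_tendsto_of_tendsto_of_le_of_le tendsto_const_nhds hδ0 (fun _ => zero_le)
      fun n => (eLpNorm_sub_comm _ _ _ _).trans_le (hφδ n).le
  obtain ⟨X, ns, hX, hns, hlim⟩ := exists_strictMono_tendsto_ae_of_cauchy_measure
    (fun n => (hM.measurable_simpleStableIntegral (hφ n)).aemeasurable)
    fun _ => hM.tendsto_measure_lt_dist_simpleStableIntegral hα hf.1 hφ hφf
  exact ⟨X, hX, φ ∘ ns, fun n => hφ _, hφf.comp hns.tendsto_atTop, tendstoInMeasure_of_tendsto_ae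
    (fun n => (hM.measurable_simpleStableIntegral (hφ _)).aestronglyMeasurable) hlim⟩

theorem isStableIntegral_stableIntegral (hM : IsSymmetricStableRandomMeasure P α m M)
    (hα : 0 < α) {f : E → ℝ} (hf : MemLp f (ENNReal.ofReal α) m) :
    IsStableIntegral P α m M f (stableIntegral P α m M f) := by
  have h := hM.exists_isStableIntegral hα hf
  rw [stableIntegral, dif_pos h]
  exact h.choose_spec

end IsSymmetricStableRandomMeasure

section Discretization

theorem IsSymmetricStableRandomMeasure.stableMotion_sub {S : Type*} [MeasurableSpace S]
    {P : Measure S} [IsProbabilityMeasure P] {α : ℝ} {M : Set ℝ → S → ℝ}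
    (hM : IsSymmetricStableRandomMeasure P α volume M) (hα : α ≠ 0) {p q : ℝ} (hpq : p ≤ q) :
    stableMotion M q - stableMotion M p =ᵐ[P] M (Set.Ioc p q) := by
  have hsplit : ∀ x y z : ℝ, x ≤ y → y ≤ z →
      M (Set.Ioc x z) =ᵐ[P] M (Set.Ioc x y) + M (Set.Ioc y z) := by
    intro x y z hxy hyz
    rw [← Set.Ioc_union_Ioc_eq_Ioc hxy hyz]
    refine hM.union hα measurableSet_Ioc measurableSet_Ioc ?_ measure_Ioc_lt_top measure_Ioc_lt_top
    rw [Set.Ioc_disjoint_Ioc]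
    simp [hxy, hyz]
  rcases le_or_gt 0 p with hp | hp
  · filter_upwards [hsplit 0 p q hp hpq] with s hs
    simp only [Pi.sub_apply, Pi.add_apply, stableMotion, if_pos hp, if_pos (hp.trans hpq)] at hs ⊢
    linarith
  rcases le_or_gt 0 q with hq | hq
  · filter_upwards [hsplit p 0 q hp.le hq] with s hs
    simp only [Pi.sub_apply, Pi.add_apply, stableMotion, if_neg hp.not_ge, if_pos hq] at hs ⊢
    linarith
  · filter_upwards [hsplit p q 0 hpq hq.le] with s hs
    simp only [Pi.sub_apply, Pi.add_apply, stableMotion, if_neg hp.not_ge, if_neg hq.not_ge]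
      at hs ⊢
    linarith

/-- The cell `[(j - 1) / ω, j / ω)` of the grid of mesh `1 / ω`. -/
def gridCell (ω : ℕ) (j : ℤ) : Set ℝ :=
  Set.Ico (((j : ℝ) - 1) / ω) ((j : ℝ) / ω)

/-- The endpoint of `gridCell ω j` farther from the origin, where the approximation `Y_{ω,Ω}`
evaluates the kernel. -/
noncomputable def gridPoint (ω : ℕ) (j : ℤ) : ℝ :=
  if j ≤ 0 then ((j : ℝ) - 1) / ω else (j : ℝ) / ω

/-- The grid point of the cell containing `u`, that is, `u` rounded away from the origin to a
multiple of `1 / ω`. -/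
noncomputable def gridRound (ω : ℕ) (u : ℝ) : ℝ :=
  gridPoint ω (⌊ω * u⌋ + 1)

/-- The step function equal to `g (gridPoint ω j)` on each of the cells that make up `[-Ω, Ω)` and
to `0` elsewhere: the kernel of the discretized moving average `Y_{ω,Ω}`. -/
noncomputable def gridApprox (g : ℝ → ℝ) (ω Ω : ℕ) : ℝ → ℝ :=
  ∑ j ∈ Finset.Icc (-((ω : ℤ) * Ω) + 1) (ω * Ω), g (gridPoint ω j) • (gridCell ω j).indicator 1

theorem mem_gridCell_iff {ω : ℕ} (hω : 0 < ω) {u : ℝ} {j : ℤ} :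
    u ∈ gridCell ω j ↔ ⌊ω * u⌋ + 1 = j := by
  have hω' : (0 : ℝ) < ω := Nat.cast_pos.2 hω
  rw [← eq_sub_iff_add_eq, Int.floor_eq_iff, gridCell, Set.mem_Ico, div_le_iff₀' hω',
    lt_div_iff₀' hω']
  push_cast
  rw [sub_add_cancel]

theorem abs_sub_gridPoint_le {ω : ℕ} {u : ℝ} {j : ℤ} (hu : u ∈ gridCell ω j) :
    |u - gridPoint ω j| ≤ 1 / ω := by
  obtain ⟨hl, hr⟩ := hu
  have hwidth : (j : ℝ) / ω - (j - 1) / ω = 1 / ω := by ring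
  rw [gridPoint]
  split_ifs <;> rw [abs_le] <;> constructor <;> linarith

theorem abs_le_abs_gridPoint {ω : ℕ} {u : ℝ} {j : ℤ} (hu : u ∈ gridCell ω j) :
    |u| ≤ |gridPoint ω j| := by
  obtain ⟨hl, hr⟩ := hu
  rw [gridPoint]
  split_ifs with hj
  · have hj' : (j : ℝ) / ω ≤ 0 := div_nonpos_of_nonpos_of_nonneg (mod_cast hj) (Nat.cast_nonneg ω)
    rw [abs_of_nonpos (by linarith), abs_of_nonpos (by linarith)]
    linarith
  · have hj' : 0 ≤ ((j : ℝ) - 1) / ω :=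
      div_nonneg (sub_nonneg.2 (mod_cast (by lia : 1 ≤ j))) (Nat.cast_nonneg ω)
    rw [abs_of_nonneg (by linarith), abs_of_nonneg (by linarith)]
    exact hr.le

theorem one_div_le_abs_gridPoint (ω : ℕ) (j : ℤ) : 1 / (ω : ℝ) ≤ |gridPoint ω j| := by
  rw [gridPoint, ← ite_div, abs_div, Nat.abs_cast]
  gcongr
  norm_cast
  exact Int.one_le_abs (by split_ifs <;> lia)

theorem abs_sub_gridRound_le {ω : ℕ} (hω : 0 < ω) (u : ℝ) : |u - gridRound ω u| ≤ 1 / ω :=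
  abs_sub_gridPoint_le ((mem_gridCell_iff hω).2 rfl)

theorem abs_le_abs_gridRound {ω : ℕ} (hω : 0 < ω) (u : ℝ) : |u| ≤ |gridRound ω u| :=
  abs_le_abs_gridPoint ((mem_gridCell_iff hω).2 rfl)

theorem gridApprox_eq_indicator (g : ℝ → ℝ) {ω : ℕ} (hω : 0 < ω) (Ω : ℕ) :
    gridApprox g ω Ω = (Set.Ico (-Ω : ℝ) Ω).indicator (g ∘ gridRound ω) := by
  classical
  ext u
  have hω' : (0 : ℝ) < ω := Nat.cast_pos.2 hω
  have hmem : ⌊ω * u⌋ + 1 ∈ Finset.Icc (-((ω : ℤ) * Ω) + 1) (ω * Ω) ↔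
      u ∈ Set.Ico (-Ω : ℝ) Ω := by
    rw [Finset.mem_Icc, Set.mem_Ico, add_le_add_iff_right, Int.add_one_le_iff, Int.le_floor,
      Int.floor_lt]
    push_cast
    rw [← mul_neg, mul_le_mul_iff_right₀ hω', mul_lt_mul_iff_right₀ hω']
  simp only [gridApprox, Finset.sum_apply, Pi.smul_apply, Set.indicator_apply,
    mem_gridCell_iff hω, Pi.one_apply, smul_eq_mul, mul_ite, mul_one, mul_zero,
    Finset.sum_ite_eq, hmem, Function.comp_apply, gridRound]

theorem measurableSet_gridCell (ω : ℕ) (j : ℤ) : MeasurableSet (gridCell ω j) :=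
  measurableSet_Ico

theorem memLp_gridApprox (g : ℝ → ℝ) (ω Ω : ℕ) (p : ENNReal) :
    MemLp (gridApprox g ω Ω) p volume :=
  memLp_finsetSum' _ fun j _ =>
    (memLp_indicator_const p (measurableSet_gridCell ω j) (1 : ℝ)
      (Or.inr measure_Ico_lt_top.ne)).const_smul (g (gridPoint ω j))

theorem movingAverageApprox_eq_sum {S : Type*} (M : Set ℝ → S → ℝ) (g : ℝ → ℝ) (ω Ω : ℕ)
    (k : ℤ) : movingAverageApprox M g ω Ω k = ∑ j ∈ Finset.Icc (-((ω : ℤ) * Ω) + 1) (ω * Ω),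
      g (gridPoint ω j) • stableIncrement M ω (ω * k - j) := by
  have : 0 ≤ (ω : ℤ) * Ω := by positivity
  have hunion : Finset.Icc (-((ω : ℤ) * Ω) + 1) (ω * Ω) =
      Finset.Icc (-((ω : ℤ) * Ω) + 1) 0 ∪ Finset.Icc 1 ((ω : ℤ) * Ω) := by
    ext j
    simp only [Finset.mem_union, Finset.mem_Icc]
    lia
  have hdisj : Disjoint (Finset.Icc (-((ω : ℤ) * Ω) + 1) 0) (Finset.Icc 1 ((ω : ℤ) * Ω)) := by
    rw [Finset.disjoint_left]
    simp only [Finset.mem_Icc]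
    lia
  ext s
  rw [hunion, Finset.sum_union hdisj, movingAverageApprox, Pi.add_apply, Finset.sum_apply,
    Finset.sum_apply]
  congr 1 <;> refine Finset.sum_congr rfl fun j hj => ?_ <;> rw [Finset.mem_Icc] at hj
  · rw [gridPoint, if_pos hj.2, Pi.smul_apply, smul_eq_mul]
  · rw [gridPoint, if_neg (by lia), Pi.smul_apply, smul_eq_mul]

variable {S : Type*} [MeasurableSpace S] {P : Measure S} [IsProbabilityMeasure P] {α : ℝ}
  {M : Set ℝ → S → ℝ} {g : ℝ → ℝ} {Y : ℝ → S → ℝ}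

theorem IsSymmetricStableRandomMeasure.stableIncrement_ae_eq
    (hM : IsSymmetricStableRandomMeasure P α volume M) (hα : α ≠ 0) (ω : ℕ) (k j : ℤ) :
    stableIncrement M ω (ω * k - j) =ᵐ[P] M ((fun x => (k : ℝ) - x) ⁻¹' gridCell ω j) := by
  have hcell : (fun x => (k : ℝ) - x) ⁻¹' gridCell ω j =
      Set.Ioc (((ω * k - j : ℤ) : ℝ) / ω) ((((ω * k - j : ℤ) : ℝ) + 1) / ω) := by
    rw [gridCell, Set.preimage_const_sub_Ico]
    rcases eq_or_ne ω 0 with rfl | hω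
    · simp
    · congr 1 <;> push_cast <;> field_simp
      ring
  rw [hcell]
  exact hM.stableMotion_sub hα (by gcongr; linarith)

theorem IsSymmetricStableRandomMeasure.movingAverageApprox_ae_eq
    (hM : IsSymmetricStableRandomMeasure P α volume M) (hα : α ≠ 0) (g : ℝ → ℝ) (ω Ω : ℕ)
    (k : ℤ) : movingAverageApprox M g ω Ω k =ᵐ[P]
      ∑ j ∈ Finset.Icc (-((ω : ℤ) * Ω) + 1) (ω * Ω),
        g (gridPoint ω j) • M ((fun x => (k : ℝ) - x) ⁻¹' gridCell ω j) := by
  rw [movingAverageApprox_eq_sum]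
  exact eventuallyEq_sum fun j _ => (hM.stableIncrement_ae_eq hα ω k j).const_smul _

theorem IsMovingAverage.hasSymmetricStableLaw_approxError (hY : IsMovingAverage P α M g Y)
    (hM : IsSymmetricStableRandomMeasure P α volume M) (hα : 0 < α)
    (hg : MemLp g (ENNReal.ofReal α) volume) (ω Ω : ℕ) (k : ℤ) :
    HasSymmetricStableLaw P α (lpNorm (g - gridApprox g ω Ω) (ENNReal.ofReal α) volume)
      (approxError M g Y ω Ω k) := by
  have hreflect := Measure.measurePreserving_sub_left volume (k : ℝ)
  have hgk := hg.comp_measurePreserving hreflect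
  have hgridApprox := memLp_gridApprox g ω Ω (ENNReal.ofReal α)
  have hgridApproxk := hgridApprox.comp_measurePreserving hreflect
  have hsum : gridApprox g ω Ω ∘ (fun x => (k : ℝ) - x) =
      ∑ j ∈ Finset.Icc (-((ω : ℤ) * Ω) + 1) (ω * Ω),
        g (gridPoint ω j) • ((fun x => (k : ℝ) - x) ⁻¹' gridCell ω j).indicator 1 := by
    ext x
    simp only [gridApprox, Function.comp_apply, Finset.sum_apply, Pi.smul_apply]
    rfl
  have hint : IsStableIntegral P α volume M (gridApprox g ω Ω ∘ fun x => (k : ℝ) - x) _ :=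
    hsum ▸ hM.isStableIntegral_sum_indicator hα.ne' _ _
      (fun j _ => hreflect.measurable (measurableSet_gridCell ω j)) fun j _ => by
        rw [hreflect.measure_preimage (measurableSet_gridCell ω j).nullMeasurableSet]
        exact measure_Ico_lt_top
  have hlaw := ((hM.isStableIntegral_stableIntegral hα hgk).sub hint hM hα.ne' hgk.1
    hgridApproxk.1).hasSymmetricStableLaw hM hα (hgk.sub hgridApproxk)
  have hnorm : lpNorm (g - gridApprox g ω Ω) (ENNReal.ofReal α) volume =
      lpNorm (g ∘ (fun x => (k : ℝ) - x) - gridApprox g ω Ω ∘ (fun x => (k : ℝ) - x))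
        (ENNReal.ofReal α) volume := by
    rw [← toReal_eLpNorm (hg.sub hgridApprox).1, ← toReal_eLpNorm (hgk.sub hgridApproxk).1]
    exact congrArg _ (eLpNorm_comp_measurePreserving (hg.sub hgridApprox).1 hreflect).symm
  rw [hnorm]
  exact hlaw.congr ((hY k).sub (hM.movingAverageApprox_ae_eq hα.ne' g ω Ω k)).symm

end Discretization

section KernelEstimates

theorem lintegral_comp_abs (f : ℝ → ENNReal) : ∫⁻ u, f |u| = 2 * ∫⁻ r in Set.Ioi 0, f r := by
  have hpos : ∫⁻ u in Set.Ioi 0, f |u| = ∫⁻ r in Set.Ioi 0, f r :=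
    setLIntegral_congr_fun measurableSet_Ioi fun u hu => by simp only [abs_of_pos hu.out]
  have hneg : ∫⁻ u in Set.Iic 0, f |u| = ∫⁻ u in Set.Ioi 0, f |u| := by
    rw [setLIntegral_congr Iio_ae_eq_Iic.symm, ← lintegral_indicator measurableSet_Iio,
      ← lintegral_indicator measurableSet_Ioi, ← lintegral_neg_eq_self]
    simp only [Set.indicator, Set.mem_Iio, Set.mem_Ioi, neg_lt_zero, abs_neg]
  rw [← lintegral_add_compl _ measurableSet_Ioi, Set.compl_Ioi, hneg, hpos, two_mul]

theorem setLIntegral_abs_ge_rpow {p R : ℝ} (hp : p < -1) (hR : 0 < R) :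
    ∫⁻ u in {u : ℝ | R ≤ |u|}, ENNReal.ofReal (|u| ^ p) =
      ENNReal.ofReal (2 / (-1 - p) * R ^ (p + 1)) := by
  have hIoi : ∫⁻ r in Set.Ioi R, ENNReal.ofReal (r ^ p) =
      ENNReal.ofReal (R ^ (p + 1) / (-1 - p)) := by
    rw [← ofReal_integral_eq_lintegral_ofReal (integrableOn_Ioi_rpow_of_lt hp hR),
      integral_Ioi_rpow_of_lt hp hR, neg_div, ← div_neg, neg_add']
    · ring_nf
    · filter_upwards [ae_restrict_mem measurableSet_Ioi] with r hr
      exact Real.rpow_nonneg (hR.trans hr).le p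
  calc ∫⁻ u in {u : ℝ | R ≤ |u|}, ENNReal.ofReal (|u| ^ p)
      = ∫⁻ u, (Set.Ici R).indicator (fun r => ENNReal.ofReal (r ^ p)) |u| :=
        (lintegral_indicator (measurableSet_le measurable_const measurable_id.abs) _).symm
    _ = 2 * ∫⁻ r in Set.Ioi R, ENNReal.ofReal (r ^ p) := by
        rw [lintegral_comp_abs, setLIntegral_indicator measurableSet_Ici, Set.inter_eq_left.2,
          setLIntegral_congr Ioi_ae_eq_Ici]
        exact Set.Ici_subset_Ioi.2 hR
    _ = ENNReal.ofReal (2 / (-1 - p) * R ^ (p + 1)) := by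
        rw [hIoi, ← ENNReal.ofReal_ofNat 2, ← ENNReal.ofReal_mul zero_le_two]
        ring_nf

theorem lintegral_max_abs_rpow {p δ : ℝ} (hp : p < -1) (hδ : 0 < δ) :
    ∫⁻ u, ENNReal.ofReal (max |u| δ ^ p) =
      ENNReal.ofReal ((2 + 2 / (-1 - p)) * δ ^ (p + 1)) := by
  have hS : MeasurableSet {u : ℝ | δ ≤ |u|} :=
    measurableSet_le measurable_const measurable_id.abs
  have hfar : ∫⁻ u in {u : ℝ | δ ≤ |u|}, ENNReal.ofReal (max |u| δ ^ p) =
      ENNReal.ofReal (2 / (-1 - p) * δ ^ (p + 1)) := by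
    rw [← setLIntegral_abs_ge_rpow hp hδ]
    exact setLIntegral_congr_fun hS fun u hu => by simp only [max_eq_left hu.out]
  have hball : {u : ℝ | δ ≤ |u|}ᶜ = Set.Ioo (-δ) δ := by
    ext u
    simp [abs_lt]
  have hnear : ∫⁻ u in {u : ℝ | δ ≤ |u|}ᶜ, ENNReal.ofReal (max |u| δ ^ p) =
      ENNReal.ofReal (2 * δ ^ (p + 1)) := by
    have hmax : ∀ u ∈ Set.Ioo (-δ) δ, ENNReal.ofReal (max |u| δ ^ p) = ENNReal.ofReal (δ ^ p) :=
      fun u hu => by rw [max_eq_right (abs_lt.2 hu).le]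
    rw [hball, setLIntegral_congr_fun measurableSet_Ioo hmax, setLIntegral_const, Real.volume_Ioo,
      ← ENNReal.ofReal_mul (Real.rpow_nonneg hδ.le p), Real.rpow_add_one hδ.ne']
    ring_nf
  have : 0 < -1 - p := by linarith
  rw [← lintegral_add_compl _ hS, hfar, hnear, ← ENNReal.ofReal_add (by positivity)
    (by positivity), ← add_mul, add_comm (2 : ℝ)]

theorem tendsto_setLIntegral_abs_ge {f : ℝ → ENNReal} (hf : ∫⁻ u, f u ≠ ⊤) :
    Tendsto (fun n : ℕ => ∫⁻ u in {u : ℝ | (n : ℝ) ≤ |u|}, f u) atTop (𝓝 0) := by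
  have hS : ∀ n : ℕ, MeasurableSet {u : ℝ | (n : ℝ) ≤ |u|} := fun n =>
    measurableSet_le measurable_const measurable_id.abs
  have hanti : Antitone fun n : ℕ => {u : ℝ | (n : ℝ) ≤ |u|} := fun n n' hn u hu =>
    (Nat.cast_le.2 hn).trans hu.out
  have hinter : ⋂ n : ℕ, {u : ℝ | (n : ℝ) ≤ |u|} = ∅ :=
    Set.eq_empty_of_forall_notMem fun u hu =>
      (exists_nat_gt |u|).elim fun n hn => hn.not_ge (Set.mem_iInter.1 hu n)
  have htotal : volume.withDensity f {u : ℝ | ((0 : ℕ) : ℝ) ≤ |u|} ≠ ⊤ := by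
    rw [withDensity_apply f (hS 0)]
    exact ((setLIntegral_le_lintegral _ f).trans_lt hf.lt_top).ne
  simpa only [Function.comp_def, withDensity_apply f (hS _), hinter, measure_empty] using
    tendsto_measure_iInter_atTop (fun n => (hS n).nullMeasurableSet) hanti ⟨0, htotal⟩

variable {α γ a c η : ℝ} {g : ℝ → ℝ}

theorem enorm_rpow_eq_ofReal (hα : 0 ≤ α) (y : ℝ) : ‖y‖ₑ ^ α = ENNReal.ofReal (|y| ^ α) := by
  rw [← ENNReal.ofReal_rpow_of_nonneg (abs_nonneg y) hα, Real.enorm_eq_ofReal_abs]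

section

variable {E F : Type*} [MeasurableSpace E] [NormedAddCommGroup F] {m : Measure E} {f : E → F}

theorem lintegral_enorm_rpow_lt_top (hα : 0 < α) (hf : MemLp f (ENNReal.ofReal α) m) :
    ∫⁻ x, ‖f x‖ₑ ^ α ∂m < ⊤ := by
  simpa [ENNReal.toReal_ofReal hα.le] using
    lintegral_rpow_enorm_lt_top_of_eLpNorm_lt_top (by simpa using hα) ENNReal.ofReal_ne_top hf.2

theorem lpNorm_ofReal_rpow (hα : 0 < α) (hf : AEStronglyMeasurable f m) :
    lpNorm f (ENNReal.ofReal α) m ^ α = (∫⁻ x, ‖f x‖ₑ ^ α ∂m).toReal := by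
  rw [← toReal_eLpNorm hf, eLpNorm_eq_lintegral_rpow_enorm_toReal (by simpa using hα)
    ENNReal.ofReal_ne_top, ENNReal.toReal_ofReal hα.le, one_div, ENNReal.toReal_rpow,
    ENNReal.rpow_inv_rpow hα.ne']

end

theorem isBigO_setLIntegral_abs_ge {β : ℝ} (hα : 0 < α) (hβ : 1 < α * β)
    (hg : g =O[cocompact ℝ] fun x => |x| ^ (-β)) :
    (fun R : ℝ => (∫⁻ u in {u : ℝ | R ≤ |u|}, ‖g u‖ₑ ^ α).toReal) =O[atTop]
      fun R => R ^ (1 - α * β) := by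
  obtain ⟨C, hC, hgC⟩ := hg.exists_pos
  rw [Asymptotics.IsBigOWith, ← Metric.cobounded_eq_cocompact, ← comap_norm_atTop,
    eventually_comap] at hgC
  refine .of_bound (C ^ α * (2 / (α * β - 1))) ?_
  filter_upwards [eventually_forall_ge_atTop.2 hgC, eventually_gt_atTop 0] with R hR hR0
  have hpt : ∀ u ∈ {u : ℝ | R ≤ |u|},
      ‖g u‖ₑ ^ α ≤ ENNReal.ofReal (C ^ α) * ENNReal.ofReal (|u| ^ (-(α * β))) := by
    intro u hu
    have hgu := hR |u| hu u rfl
    rw [Real.norm_eq_abs, Real.norm_of_nonneg (by positivity)] at hgu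
    rw [enorm_rpow_eq_ofReal hα.le, ← ENNReal.ofReal_mul (by positivity), mul_comm α, ← neg_mul,
      Real.rpow_mul (abs_nonneg u), ← Real.mul_rpow hC.le (by positivity)]
    gcongr
  have : 0 < α * β - 1 := sub_pos.2 hβ
  rw [Real.norm_of_nonneg ENNReal.toReal_nonneg, Real.norm_of_nonneg (by positivity)]
  refine ENNReal.toReal_le_of_le_ofReal (by positivity) ?_
  calc ∫⁻ u in {u : ℝ | R ≤ |u|}, ‖g u‖ₑ ^ α
      ≤ ∫⁻ u in {u : ℝ | R ≤ |u|},
          ENNReal.ofReal (C ^ α) * ENNReal.ofReal (|u| ^ (-(α * β))) :=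
        setLIntegral_mono (by fun_prop) hpt
    _ = ENNReal.ofReal (C ^ α * (2 / (α * β - 1)) * R ^ (1 - α * β)) := by
        rw [lintegral_const_mul' _ _ ENNReal.ofReal_ne_top,
          setLIntegral_abs_ge_rpow (by linarith) hR0, ← ENNReal.ofReal_mul (by positivity)]
        ring_nf

theorem abs_sub_le_max_rpow (hc : 0 ≤ c) (ha : 0 ≤ a) (hγa : γ ≤ a)
    (hinc : ∀ u h : ℝ, u ≠ 0 → |h| < η → |g (u + h) - g u| ≤ c * |h| ^ a * |u| ^ (γ - a))
    {u v δ : ℝ} (hδ : 0 < δ) (hδη : δ < η) (huv : |u| ≤ |v|) (hδv : δ ≤ |v|)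
    (hsub : |u - v| ≤ δ) : |g u - g v| ≤ c * δ ^ a * max |u| δ ^ (γ - a) := by
  have hinc' := hinc v (u - v) (abs_pos.1 (hδ.trans_le hδv)) (hsub.trans_lt hδη)
  rw [add_sub_cancel] at hinc'
  refine hinc'.trans ?_
  gcongr ?_ * ?_ ^ _ * ?_
  exact Real.rpow_le_rpow_of_nonpos (lt_max_of_lt_right hδ) (max_le huv hδv) (by linarith)

theorem lintegral_enorm_sub_comp_rpow_le (hα : 0 < α) (hc : 0 ≤ c) (ha : 0 ≤ a)
    (hγa : α * (γ - a) < -1)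
    (hinc : ∀ u h : ℝ, u ≠ 0 → |h| < η → |g (u + h) - g u| ≤ c * |h| ^ a * |u| ^ (γ - a))
    {ρ : ℝ → ℝ} {δ : ℝ} (hδ : 0 < δ) (hδη : δ < η) (hρ : ∀ u, |u| ≤ |ρ u|)
    (hδρ : ∀ u, δ ≤ |ρ u|) (hsub : ∀ u, |u - ρ u| ≤ δ) :
    ∫⁻ u, ‖g u - g (ρ u)‖ₑ ^ α ≤
      ENNReal.ofReal (c ^ α * (2 + 2 / (-1 - α * (γ - a))) * δ ^ (1 + α * γ)) := by
  have hγa' : γ ≤ a := by nlinarith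
  have hpt : ∀ u, ‖g u - g (ρ u)‖ₑ ^ α ≤
      ENNReal.ofReal ((c * δ ^ a) ^ α) * ENNReal.ofReal (max |u| δ ^ (α * (γ - a))) := by
    intro u
    have hmax : 0 < max |u| δ := lt_max_of_lt_right hδ
    rw [enorm_rpow_eq_ofReal hα.le, ← ENNReal.ofReal_mul (by positivity), mul_comm α,
      Real.rpow_mul hmax.le, ← Real.mul_rpow (by positivity) (by positivity)]
    gcongr
    exact abs_sub_le_max_rpow hc ha hγa' hinc hδ hδη (hρ u) (hδρ u) (hsub u)
  calc ∫⁻ u, ‖g u - g (ρ u)‖ₑ ^ α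
      ≤ ∫⁻ u, ENNReal.ofReal ((c * δ ^ a) ^ α) * ENNReal.ofReal (max |u| δ ^ (α * (γ - a))) :=
        lintegral_mono hpt
    _ = ENNReal.ofReal (c ^ α * (2 + 2 / (-1 - α * (γ - a))) * δ ^ (1 + α * γ)) := by
        rw [lintegral_const_mul' _ _ ENNReal.ofReal_ne_top, lintegral_max_abs_rpow hγa hδ,
          ← ENNReal.ofReal_mul (by positivity), Real.mul_rpow hc (by positivity),
          ← Real.rpow_mul hδ.le, show 1 + α * γ = a * α + (α * (γ - a) + 1) by ring,
          Real.rpow_add hδ (a * α)]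
        congr 1
        ring

theorem exists_lintegral_enorm_sub_gridApprox_rpow_le (hα : 0 < α) (hc : 0 ≤ c) (ha : 0 ≤ a)
    (hη : 0 < η) (hγa : α * (γ - a) < -1)
    (hinc : ∀ u h : ℝ, u ≠ 0 → |h| < η → |g (u + h) - g u| ≤ c * |h| ^ a * |u| ^ (γ - a)) :
    ∃ K : ℝ, 0 ≤ K ∧ ∀ ω Ω : ℕ, 1 / η < ω →
      ∫⁻ u, ‖(g - gridApprox g ω Ω) u‖ₑ ^ α ≤
        ENNReal.ofReal (K * (ω : ℝ) ^ (-1 - α * γ)) +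
          ∫⁻ u in {u : ℝ | (Ω : ℝ) ≤ |u|}, ‖g u‖ₑ ^ α := by
  have : 0 < -1 - α * (γ - a) := by linarith
  refine ⟨c ^ α * (2 + 2 / (-1 - α * (γ - a))), by positivity, fun ω Ω hω => ?_⟩
  have hω' : (0 : ℝ) < ω := (one_div_pos.2 hη).trans hω
  have hω0 : 0 < ω := Nat.cast_pos.1 hω'
  have hround := lintegral_enorm_sub_comp_rpow_le hα hc ha hγa hinc (one_div_pos.2 hω')
    ((one_div_lt hη hω').1 hω) (abs_le_abs_gridRound hω0)
    (fun u => one_div_le_abs_gridPoint ω (⌊ω * u⌋ + 1)) (abs_sub_gridRound_le hω0)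
  rw [one_div, Real.inv_rpow hω'.le, ← Real.rpow_neg hω'.le, neg_add'] at hround
  rw [gridApprox_eq_indicator g hω0,
    ← lintegral_add_compl _ (measurableSet_Ico (a := -(Ω : ℝ)) (b := Ω))]
  refine add_le_add ?_ ?_
  · refine le_trans ?_ ((setLIntegral_le_lintegral (Set.Ico (-Ω : ℝ) Ω) _).trans hround)
    refine (setLIntegral_congr_fun measurableSet_Ico fun u hu => ?_).le
    simp only [Pi.sub_apply, Set.indicator_of_mem hu, Function.comp_apply]
  · have hsubset : (Set.Ico (-Ω : ℝ) Ω)ᶜ ⊆ {u : ℝ | (Ω : ℝ) ≤ |u|} := fun u hu => by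
      by_contra hlt
      exact hu ⟨(abs_lt.1 (not_le.1 hlt)).1.le, (abs_lt.1 (not_le.1 hlt)).2⟩
    refine le_trans ?_ (lintegral_mono_set hsubset)
    refine (setLIntegral_congr_fun measurableSet_Ico.compl fun u hu => ?_).le
    simp only [Pi.sub_apply, Set.indicator_of_notMem hu, sub_zero]

end KernelEstimates

section Error

variable {S : Type*} [MeasurableSpace S] {P : Measure S} [IsProbabilityMeasure P]
  {α γ a c η : ℝ} {M : Set ℝ → S → ℝ} {g : ℝ → ℝ} {Y : ℝ → S → ℝ}

theorem IsMovingAverage.stableNorm_approxError_rpow (hY : IsMovingAverage P α M g Y)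
    (hM : IsSymmetricStableRandomMeasure P α volume M) (hα : 0 < α)
    (hg : MemLp g (ENNReal.ofReal α) volume) (ω Ω : ℕ) (k : ℤ) :
    stableNorm P α (approxError M g Y ω Ω k) ^ α =
      (∫⁻ u, ‖(g - gridApprox g ω Ω) u‖ₑ ^ α).toReal := by
  rw [(hY.hasSymmetricStableLaw_approxError hM hα hg ω Ω k).stableNorm_eq hα,
    lpNorm_ofReal_rpow hα (hg.sub (memLp_gridApprox g ω Ω _)).1]

theorem IsMovingAverage.exists_stableNorm_approxError_rpow_le_add
    (hY : IsMovingAverage P α M g Y) (hM : IsSymmetricStableRandomMeasure P α volume M)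
    (hα : 0 < α) (hg : MemLp g (ENNReal.ofReal α) volume) (hc : 0 ≤ c) (ha : 0 ≤ a) (hη : 0 < η)
    (hγa : α * (γ - a) < -1)
    (hinc : ∀ u h : ℝ, u ≠ 0 → |h| < η → |g (u + h) - g u| ≤ c * |h| ^ a * |u| ^ (γ - a)) :
    ∃ K : ℝ, 0 ≤ K ∧ ∀ (ω Ω : ℕ) (k : ℤ), 1 / η < ω →
      stableNorm P α (approxError M g Y ω Ω k) ^ α ≤ K * (ω : ℝ) ^ (-1 - α * γ) +
        (∫⁻ u in {u : ℝ | (Ω : ℝ) ≤ |u|}, ‖g u‖ₑ ^ α).toReal := by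
  obtain ⟨K, hK, hle⟩ := exists_lintegral_enorm_sub_gridApprox_rpow_le hα hc ha hη hγa hinc
  refine ⟨K, hK, fun ω Ω k hω => ?_⟩
  have htail : ∫⁻ u in {u : ℝ | (Ω : ℝ) ≤ |u|}, ‖g u‖ₑ ^ α ≠ ⊤ :=
    ((setLIntegral_le_lintegral _ _).trans_lt (lintegral_enorm_rpow_lt_top hα hg)).ne
  have hK' : 0 ≤ K * (ω : ℝ) ^ (-1 - α * γ) := by positivity
  rw [hY.stableNorm_approxError_rpow hM hα hg, ← ENNReal.toReal_ofReal hK',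
    ← ENNReal.toReal_add ENNReal.ofReal_ne_top htail]
  exact ENNReal.toReal_mono (ENNReal.add_ne_top.2 ⟨ENNReal.ofReal_ne_top, htail⟩) (hle ω Ω hω)

theorem IsMovingAverage.tendsto_stableNorm_approxError
    (hY : IsMovingAverage P α M g Y) (hM : IsSymmetricStableRandomMeasure P α volume M)
    (hα : 0 < α) (hg : MemLp g (ENNReal.ofReal α) volume) (hc : 0 ≤ c) (ha : 0 ≤ a) (hη : 0 < η)
    (hγ : 0 < 1 + α * γ) (hγa : α * (γ - a) < -1)
    (hinc : ∀ u h : ℝ, u ≠ 0 → |h| < η → |g (u + h) - g u| ≤ c * |h| ^ a * |u| ^ (γ - a))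
    (k : ℤ) :
    Tendsto (fun p : ℕ × ℕ => stableNorm P α (approxError M g Y p.1 p.2 k)) (atTop ×ˢ atTop)
      (𝓝 0) := by
  obtain ⟨K, -, hle⟩ :=
    hY.exists_stableNorm_approxError_rpow_le_add hM hα hg hc ha hη hγa hinc
  have hmesh : Tendsto (fun ω : ℕ => K * (ω : ℝ) ^ (-1 - α * γ)) atTop (𝓝 0) := by
    rw [← mul_zero K, ← neg_add']
    exact ((tendsto_rpow_neg_atTop hγ).comp tendsto_natCast_atTop_atTop).const_mul K
  have htail : Tendsto (fun Ω : ℕ => (∫⁻ u in {u : ℝ | (Ω : ℝ) ≤ |u|}, ‖g u‖ₑ ^ α).toReal)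
      atTop (𝓝 0) :=
    (ENNReal.tendsto_toReal ENNReal.zero_ne_top).comp
      (tendsto_setLIntegral_abs_ge (lintegral_enorm_rpow_lt_top hα hg).ne)
  have hnonneg : ∀ p : ℕ × ℕ, 0 ≤ stableNorm P α (approxError M g Y p.1 p.2 k) := fun p =>
    Real.sInf_nonneg fun _ hσ => hσ.1
  have hpow : Tendsto (fun p : ℕ × ℕ => stableNorm P α (approxError M g Y p.1 p.2 k) ^ α)
      (atTop ×ˢ atTop) (𝓝 0) := by
    refine squeeze_zero' (.of_forall fun p => Real.rpow_nonneg (hnonneg p) α) ?_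
      (by simpa using (hmesh.comp tendsto_fst).add (htail.comp tendsto_snd))
    filter_upwards [tendsto_fst.eventually
      (tendsto_natCast_atTop_atTop.eventually_gt_atTop (1 / η))] with p hp
    exact hle p.1 p.2 k hp
  have hroot := hpow.rpow_const (p := α⁻¹) (Or.inr (inv_pos.2 hα).le)
  rw [Real.zero_rpow (inv_pos.2 hα).ne'] at hroot
  exact hroot.congr fun p => Real.rpow_rpow_inv (hnonneg p) hα.ne'

theorem IsMovingAverage.exists_stableNorm_approxError_rpow_le
    (hY : IsMovingAverage P α M g Y) (hM : IsSymmetricStableRandomMeasure P α volume M)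
    (hα : 0 < α) (hg : MemLp g (ENNReal.ofReal α) volume) (hc : 0 ≤ c) (ha : 0 ≤ a) (hη : 0 < η)
    (hγa : α * (γ - a) < -1)
    (hinc : ∀ u h : ℝ, u ≠ 0 → |h| < η → |g (u + h) - g u| ≤ c * |h| ^ a * |u| ^ (γ - a))
    {β : ℝ} (hβ : 1 < α * β) (hdec : g =O[cocompact ℝ] fun x => |x| ^ (-β)) :
    ∃ K : ℝ, 0 < K ∧ ∀ (ω Ω : ℕ) (k : ℤ), 1 / η < (ω : ℝ) → 1 ≤ Ω →
      stableNorm P α (approxError M g Y ω Ω k) ^ α ≤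
        K * ((ω : ℝ) ^ (-1 - α * γ) + (Ω : ℝ) ^ (1 - α * β)) := by
  obtain ⟨K, -, hle⟩ :=
    hY.exists_stableNorm_approxError_rpow_le_add hM hα hg hc ha hη hγa hinc
  obtain ⟨C, hC, htail⟩ := Asymptotics.bound_of_isBigO_nat_atTop
    ((isBigO_setLIntegral_abs_ge hα hβ hdec).comp_tendsto tendsto_natCast_atTop_atTop)
  refine ⟨max K C, lt_max_of_lt_right hC, fun ω Ω k hω hΩ => ?_⟩
  have hΩ' : (0 : ℝ) < Ω := Nat.cast_pos.2 hΩ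
  have htailΩ := htail (x := Ω) (Real.rpow_pos_of_pos hΩ' _).ne'
  simp only [Function.comp_apply] at htailΩ
  rw [Real.norm_of_nonneg ENNReal.toReal_nonneg, Real.norm_of_nonneg (by positivity)] at htailΩ
  calc stableNorm P α (approxError M g Y ω Ω k) ^ α
      ≤ K * (ω : ℝ) ^ (-1 - α * γ) + C * (Ω : ℝ) ^ (1 - α * β) :=
        (hle ω Ω k hω).trans (by gcongr)
    _ ≤ max K C * (ω : ℝ) ^ (-1 - α * γ) + max K C * (Ω : ℝ) ^ (1 - α * β) := by
        gcongr
        exacts [le_max_left K C, le_max_right K C]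
    _ = max K C * ((ω : ℝ) ^ (-1 - α * γ) + (Ω : ℝ) ^ (1 - α * β)) := (mul_add _ _ _).symm

end Error

theorem corollary5p2_general {S : Type*} [MeasurableSpace S] {P : Measure S}
    [IsProbabilityMeasure P] {α : ℝ} (hα : 0 < α)
    {M : Set ℝ → S → ℝ} (hM : IsSymmetricStableRandomMeasure P α volume M)
    {g : ℝ → ℝ} (hg : MemLp g (ENNReal.ofReal α) volume)
    {γ a c η : ℝ} (hc : 0 ≤ c) (hη : 0 < η) (hγ : 0 < γ + 1 / α) (hγa : γ + 1 / α < a)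
    (hinc : ∀ u h : ℝ, u ≠ 0 → |h| < η → |g (u + h) - g u| ≤ c * |h| ^ a * |u| ^ (γ - a))
    {Y : ℝ → S → ℝ} (hY : IsMovingAverage P α M g Y) :
    (∀ (ω Ω : ℕ) (k : ℤ), HasSymmetricStableLaw P α
      (stableNorm P α (approxError M g Y ω Ω k)) (approxError M g Y ω Ω k)) ∧
    (∀ k : ℤ, Tendsto (fun p : ℕ × ℕ => stableNorm P α (approxError M g Y p.1 p.2 k))
      (atTop ×ˢ atTop) (𝓝 0)) ∧
    (∀ β : ℝ, 1 / α < β → (g =O[cocompact ℝ] fun x => |x| ^ (-β)) →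
      ∃ K : ℝ, 0 < K ∧ ∀ (ω Ω : ℕ) (k : ℤ), 1 / η < (ω : ℝ) → 1 ≤ Ω →
        stableNorm P α (approxError M g Y ω Ω k) ^ α ≤
          K * ((ω : ℝ) ^ (-1 - α * γ) + (Ω : ℝ) ^ (1 - α * β))) := by
  have hα' : α * (1 / α) = 1 := mul_one_div_cancel hα.ne'
  have ha : 0 ≤ a := (hγ.trans hγa).le
  have hγ' : 0 < 1 + α * γ := by nlinarith
  have hγa' : α * (γ - a) < -1 := by nlinarith
  refine ⟨fun ω Ω k => ?_, hY.tendsto_stableNorm_approxError hM hα hg hc ha hη hγ' hγa' hinc,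
    fun β hβ => hY.exists_stableNorm_approxError_rpow_le hM hα hg hc ha hη hγa' hinc
      ((div_lt_iff₀' hα).1 hβ)⟩
  have hlaw := hY.hasSymmetricStableLaw_approxError hM hα hg ω Ω k
  rwa [hlaw.stableNorm_eq hα]

theorem corollary5p2 {S : Type*} [MeasurableSpace S] (P : Measure S) [IsProbabilityMeasure P]
    (α : ℝ) (hα0 : 0 < α) (hα2 : α ≤ 2)
    (M : Set ℝ → S → ℝ) (hM : IsSymmetricStableRandomMeasure P α volume M)
    (g : ℝ → ℝ) (hg : MemLp g (ENNReal.ofReal α) volume)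
    (c₀p c₀m γ a c η : ℝ) (hc : 0 < c) (hη : 0 < η)
    (hγ : 0 < γ + 1 / α) (hγa : γ + 1 / α < a) (ha : a ≤ 1)
    (hgp : Tendsto (fun r : ℝ => g r / r ^ γ) (𝓝[>] 0) (𝓝 c₀p))
    (hgm : Tendsto (fun r : ℝ => g (-r) / r ^ γ) (𝓝[>] 0) (𝓝 c₀m))
    (hinc : ∀ u h : ℝ, u ≠ 0 → |h| < η → |g (u + h) - g u| ≤ c * |h| ^ a * |u| ^ (γ - a))
    (Y : ℝ → S → ℝ) (hY : IsMovingAverage P α M g Y) :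
    -- the error is symmetric stable, so that its `α`-norm (scale factor) is meaningful
    (∀ (ω Ω : ℕ) (k : ℤ), HasSymmetricStableLaw P α
      (stableNorm P α (approxError M g Y ω Ω k)) (approxError M g Y ω Ω k)) ∧
    (∀ k : ℤ, Tendsto (fun p : ℕ × ℕ => stableNorm P α (approxError M g Y p.1 p.2 k))
      (atTop ×ˢ atTop) (𝓝 0)) ∧
    (∀ C β : ℝ, 0 < C → 1 / α < β →
      (∀ᶠ x : ℝ in cocompact ℝ, |g x| ≤ C * |x| ^ (-β)) →
      ∃ K : ℝ, 0 < K ∧ ∀ (ω Ω : ℕ) (k : ℤ), 1 / η < (ω : ℝ) → 1 ≤ Ω →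
        stableNorm P α (approxError M g Y ω Ω k) ^ α ≤
          K * ((ω : ℝ) ^ (-1 - α * γ) + (Ω : ℝ) ^ (1 - α * β))) := by
  obtain ⟨hlaw, htendsto, hrate⟩ := corollary5p2_general hα0 hM hg hc.le hη hγ hγa hinc hY
  exact ⟨hlaw, htendsto, fun C β _ hβ hdec => hrate β hβ <| .of_bound C <| hdec.mono fun x hx => by
    rwa [Real.norm_eq_abs, Real.norm_of_nonneg (Real.rpow_nonneg (abs_nonneg x) (-β))]⟩
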